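/- Let $B_6$ be the group of all $6\times 6$ orthogonal matrices with integer entries (the hyperoctahedral group). Label the vertices of a regular icosahedron by $1,\dots,12$, with opposite vertices labelled $k$ and $k+6$, so that the icosahedral rotation group $\mathcal I$ is identified with the permutation group generated by \[ g_2=(1,6)(2,5)(3,9)(4,10)(7,12)(8,11),\qquad g_3=(1,5,6)(2,9,4)(7,11,12)(3,10,8). \] Let $\rho:\mathcal I\to B_6$ be the injective homomorphism sending $p$ to the matrix whose $(i,j)$ entry ($1\le i,j\le 6$) is $1$ if $p(j)=i$, $-1$ if $p(j)=i+6$, and $0$ otherwise. Put $\hat{\mathcal I}=\rho(\mathcal I)$. For a subgroup $H\le B_6$ let $\mathcal C_{B_6}(H)=\{gHg^{-1}: g\in B_6\}$. The elements of $\mathcal C_{B_6}(\hat{\mathcal I})$ are called the crystallographic representations of $\mathcal I$ in $B_6$. For a subgroup $\mathcal G\le\mathcal I$, the $\mathcal G$-graph is the simple graph with vertex set $\mathcal C_{B_6}(\hat{\mathcal I})$ in which two distinct vertices $\mathcal H_1,\mathcal H_2$ are adjacent if and only if $\mathcal H_1\cap\mathcal H_2\in\mathcal C_{B_6}(\rho(\mathcal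 G))$. Let $A_{\mathcal G}$ be its adjacency matrix. Let $\mathcal G$ be a maximal (proper) subgroup of $\mathcal I$. Then the $\mathcal G$-graph is triangle-free: no three of its vertices are pairwise adjacent, and it has no circuit of length three (a circuit being a closed walk of positive length with pairwise distinct edges). Moreover, every diagonal entry of $A_{\mathcal G}^3$ is zero. -/

import Mathlib

namespace IcosahedralGraph

/-- The hyperoctahedral group `B₆ = O(6) ∩ GL(6, ℤ)`: orthogonal integral `6 × 6` matrices. -/
abbrev B6 : Type := Matrix.orthogonalGroup (Fin 6) ℤ

/-! ### The icosahedral group acting on the vertices of the icosahedron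

The twelve vertices are labelled by `Fin 12`, the label `k` standing for the vertex usually
numbered `k + 1`; the vertices `k` and `k + 6` are opposite. -/

/-- The antipodal map of the vertices, `k ↦ k + 6` modulo `12`. -/
def antipode : Equiv.Perm (Fin 12) := Equiv.addRight 6

/-- The two-fold rotation `(1,6)(2,5)(3,9)(4,10)(7,12)(8,11)` (labels shifted by one). -/
def g2 : Equiv.Perm (Fin 12) :=
  c[0, 5] * c[1, 4] * c[2, 8] * c[3, 9] * c[6, 11] * c[7, 10]

/-- The three-fold rotation `(1,5,6)(2,9,4)(7,11,12)(3,10,8)` (labels shifted by one). -/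
def g3 : Equiv.Perm (Fin 12) :=
  c[0, 4, 5] * c[1, 8, 3] * c[6, 10, 11] * c[2, 9, 7]

/-- The icosahedral group `I`: the rotations of the regular icosahedron, as permutations of its
twelve vertices. -/
def icoGroup : Subgroup (Equiv.Perm (Fin 12)) := Subgroup.closure {g2, g3}

/-- The permutations of the vertices that map opposite vertices to opposite vertices
(a copy of the wreath product of `ℤ/2` with `S₆`). -/
def signedPerms : Subgroup (Equiv.Perm (Fin 12)) := Subgroup.centralizer {antipode}

theorem icoGroup_le_signedPerms : icoGroup ≤ signedPerms := by
  refine (Subgroup.closure_le _).2 ?_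
  rintro p (rfl | rfl) <;>
    · refine Subgroup.mem_centralizer_singleton_iff.2 ?_
      decide

/-! ### The passage from permutations of `±1, …, ±6` to signed permutation matrices -/

/-- The vector attached to a vertex: the basis vector `e_k` for `k < 6`, and `-e_{k-6}` for
`k ≥ 6`. -/
def vertexVec (v : Fin 12) (i : Fin 6) : ℤ :=
  if v = Fin.castAdd 6 i then 1 else if v = Fin.natAdd 6 i then -1 else 0

/-- The matrix whose `j`-th column is the vector attached to the image of the `j`-th vertex:
the `(i, j)` entry is `1` if `p j = i`, it is `-1` if `p j = i + 6`, and `0` otherwise. -/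
def signedMatrix (p : Equiv.Perm (Fin 12)) : Matrix (Fin 6) (Fin 6) ℤ :=
  Matrix.of fun i j => vertexVec (p (Fin.castAdd 6 j)) i

theorem vertexVec_antipode (v : Fin 12) (i : Fin 6) :
    vertexVec (antipode v) i = -vertexVec v i := by
  revert v i; decide

theorem vertexVec_dot (v w : Fin 12) :
    ∑ i, vertexVec v i * vertexVec w i =
      (if v = w then 1 else 0) - (if v = antipode w then 1 else 0) := by
  revert v w; decide

theorem apply_antipode {p : Equiv.Perm (Fin 12)} (hp : p ∈ signedPerms) (v : Fin 12) :
    p (antipode v) = antipode (p v) :=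
  congrArg (fun q : Equiv.Perm (Fin 12) => q v) (Subgroup.mem_centralizer_singleton_iff.1 hp)

theorem exists_vertex (v : Fin 12) :
    ∃ k : Fin 6, v = Fin.castAdd 6 k ∨ v = antipode (Fin.castAdd 6 k) := by
  revert v; decide

theorem vertexVec_castAdd (k i : Fin 6) :
    vertexVec (Fin.castAdd 6 k) i = if i = k then 1 else 0 := by
  revert k i; decide

theorem sum_signedMatrix_mul {p : Equiv.Perm (Fin 12)} (hp : p ∈ signedPerms) (v : Fin 12)
    (i : Fin 6) : ∑ k, signedMatrix p i k * vertexVec v k = vertexVec (p v) i := by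
  obtain ⟨j, rfl | rfl⟩ := exists_vertex v
  · simp [vertexVec_castAdd, signedMatrix]
  · simp [vertexVec_antipode, apply_antipode hp, vertexVec_castAdd, signedMatrix]

theorem signedMatrix_mul {p : Equiv.Perm (Fin 12)} (hp : p ∈ signedPerms)
    (q : Equiv.Perm (Fin 12)) : signedMatrix (p * q) = signedMatrix p * signedMatrix q := by
  ext i j
  rw [Matrix.mul_apply]
  exact (sum_signedMatrix_mul hp _ i).symm

theorem signedMatrix_one : signedMatrix 1 = 1 := by
  decide

theorem signedMatrix_mem {p : Equiv.Perm (Fin 12)} (hp : p ∈ signedPerms) :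
    signedMatrix p ∈ Matrix.orthogonalGroup (Fin 6) ℤ := by
  rw [Matrix.mem_orthogonalGroup_iff']
  ext i j
  have h : ∀ i j : Fin 6,
      (Fin.castAdd 6 i : Fin 12) ≠ antipode (Fin.castAdd 6 j) := by decide
  have h1 := vertexVec_dot (p (Fin.castAdd 6 i)) (p (Fin.castAdd 6 j))
  rw [← apply_antipode hp] at h1
  simp only [EmbeddingLike.apply_eq_iff_eq, h i j, if_false, sub_zero] at h1
  have h2 : (Fin.castAdd 6 i : Fin 12) = Fin.castAdd 6 j ↔ i = j := Fin.castAdd_inj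
  rw [if_congr h2 rfl rfl] at h1
  simpa [Matrix.mul_apply, Matrix.star_apply, signedMatrix, Matrix.one_apply] using h1

/-- The representation `I → B₆` induced by the action of `I` on the twelve vertices. -/
def icoRep : icoGroup →* B6 where
  toFun p := ⟨signedMatrix p, signedMatrix_mem (icoGroup_le_signedPerms p.2)⟩
  map_one' := Subtype.ext signedMatrix_one
  map_mul' p q := Subtype.ext (signedMatrix_mul (icoGroup_le_signedPerms p.2) q)

/-! ### Conjugacy classes of subgroups and the graphs -/

/-- The conjugacy class `{g H g⁻¹ : g ∈ G}` of a subgroup `H` of `G`. -/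
def conjClass {G : Type*} [Group G] (H : Subgroup G) : Set (Subgroup G) :=
  {K | ∃ g : G, K = H.map (MulAut.conj g).toMonoidHom}

/-- The crystallographic representations of `I` in `B₆`: the conjugacy class in `B₆` of the image
of `I` under `icoRep`. -/
abbrev CrystRep : Type := conjClass icoRep.range

/-- The subgroup `K_G` of `B₆` that represents a subgroup `G` of `I`. -/
def repOfSubgroup (G : Subgroup icoGroup) : Subgroup B6 := G.map icoRep

/-- The `G`-graph: two distinct crystallographic representations are adjacent if their
intersection belongs to the conjugacy class of `K_G` in `B₆`. -/
def subgroupGraph (G : Subgroup icoGroup) : SimpleGraph CrystRep where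
  Adj H₁ H₂ := H₁ ≠ H₂ ∧ ∃ P ∈ conjClass (repOfSubgroup G), P = H₁.1 ⊓ H₂.1
  symm := ⟨fun H₁ H₂ h => ⟨h.1.symm, by rw [inf_comm]; exact h.2⟩⟩
  loopless := ⟨fun _ h => h.1 rfl⟩

/-! ### Finiteness, needed for powers of the adjacency matrix -/

theorem entry_mem (A : B6) (i j : Fin 6) : A.1 i j ∈ Finset.Icc (-1 : ℤ) 1 := by
  have h := congrFun (congrFun (Matrix.mem_orthogonalGroup_iff (Fin 6) ℤ |>.1 A.2) i) i
  simp only [Matrix.mul_apply, Matrix.one_apply_eq] at h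
  have h2 : A.1 i j * A.1 i j ≤ 1 := h ▸ Finset.single_le_sum
    (f := fun k => A.1 i k * A.1 i k) (fun k _ => mul_self_nonneg _) (Finset.mem_univ j)
  rw [Finset.mem_Icc]
  constructor <;> nlinarith

instance : Finite B6 :=
  Finite.of_injective
    (fun (A : B6) (i j : Fin 6) => (⟨A.1 i j, entry_mem A i j⟩ : Finset.Icc (-1 : ℤ) 1))
    fun _ _ h => Subtype.ext <| Matrix.ext fun i j =>
      congrArg Subtype.val (congrFun (congrFun h i) j)

noncomputable instance : Fintype CrystRep := Fintype.ofFinite _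

end IcosahedralGraph

/-! The graph of a maximal subgroup is bipartite, hence has no closed walk of odd length. The colour
of a representation is the determinant of a matrix that conjugates the standard representation into
it.

Adjacent representations share a conjugate of a maximal subgroup, and maximal subgroups are not
abelian (`exists_not_commute_of_isCoatom`), so they share two elements that do not commute. If the
conjugating matrices `g₁`, `g₂` have equal determinants, then `g₂⁻¹ * g₁` is a signed permutation of
determinant 1 carrying two non-commuting rotations to rotations. The rigidity statement
`conj_mem_icoGroup` says that it then normalizes the icosahedral group, so the two representations
coincide.

Rigidity is a finite check. One of the two rotations may be taken of order 3 or 5 and, after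
conjugation by rotations, equal to `g3` or `g5` with image `g3`, `g5` or `g5 * g5`. A signed
permutation intertwining such a pair is determined by two of its values, so few candidates remain.
The kernel tests them on permutations stored as lists of naturals. -/

namespace IcosahedralGraph

/-! ### Permutations of the vertices as lists of numbers -/

/-- The list of the values of a permutation of the vertices. -/
def code (p : Equiv.Perm (Fin 12)) : List ℕ := List.ofFn fun v => (p v : ℕ)

/-- The composition of two lists of values. -/
def codeMul (l m : List ℕ) : List ℕ := m.map fun v => l.getD v 0

/-- Whether the compositions `a ∘ b` and `c ∘ d` of lists of values agree on the vertices. -/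
def codeMulEq (a b c d : List ℕ) : Bool :=
  (List.range 12).all fun v =>
    Nat.beq (a.getD (b.getD v 0) 0) (c.getD (d.getD v 0) 0)

theorem code_getD (p : Equiv.Perm (Fin 12)) (v : Fin 12) : (code p).getD v 0 = p v := by
  rw [List.getD_eq_getElem _ _ (by rw [code, List.length_ofFn]; exact v.2)]
  simp only [code, List.getElem_ofFn]

theorem code_mul (p q : Equiv.Perm (Fin 12)) : code (p * q) = codeMul (code p) (code q) := by
  simp only [codeMul, code, List.map_ofFn]
  congr 1
  ext v
  exact (code_getD p (q v)).symm

theorem codeMulEq_iff (a b c d : Equiv.Perm (Fin 12)) :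
    codeMulEq (code a) (code b) (code c) (code d) = true ↔ a * b = c * d := by
  have h (v : Fin 12) : Nat.beq ((code a).getD ((code b).getD v 0) 0)
      ((code c).getD ((code d).getD v 0) 0) = true ↔ (a * b) v = (c * d) v := by
    simp only [code_getD, Nat.beq_eq, Equiv.Perm.mul_apply, Fin.ext_iff]
  simp only [codeMulEq, List.all_eq_true, List.mem_range]
  exact ⟨fun hv => Equiv.ext fun v => (h v).1 (hv v v.2),
    fun hv v hlt => (h ⟨v, hlt⟩).2 (by rw [hv])⟩

/-! ### The sixty rotations -/

/-- Words in `g2` (`true`) and `g3` (`false`) that represent the rotations moving the sixth vertex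
to the first, second, … vertex. -/
def transversalWords : List (List Bool) :=
  [[true], [true, false, true], [true, false, true, false, true], [false, false, true, false,
   true], [false, true], [], [true, false, true, false, false, true, false, true, false, true],
   [false, false, true, false, true, false, true], [false, true, false, true], [false, true,
   false, true, false, true], [true, false, false, true, false, true, false, true], [false,
   true, false, false, true, false, true, false, true]]

/-- The rotation represented by a word. -/
def evalWord : List Bool → Equiv.Perm (Fin 12)
  | [] => 1
  | b :: w => (if b then g2 else g3) * evalWord w

/-- The list of values of the rotation represented by a word. -/
def evalWordCode : List Bool → List ℕ
  | [] => [0, 1, 2, 3, 4, 5, 6, 7, 8, 9, 10, 11]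
  | b :: w => codeMul
      (if b then [5, 4, 8, 9, 1, 0, 11, 10, 2, 3, 7, 6] else [4, 8, 9, 1, 5, 0, 10, 2, 3, 7, 11, 6])
      (evalWordCode w)

/-- The lists of values of the sixty rotations. -/
def icoCodes : List (List ℕ) :=
  [[5, 4, 8, 9, 1, 0, 11, 10, 2, 3, 7, 6], [4, 8, 9, 1, 5, 0, 10, 2, 3, 7, 11, 6],
   [8, 9, 1, 5, 4, 0, 2, 3, 7, 11, 10, 6], [9, 1, 5, 4, 8, 0, 3, 7, 11, 10, 2, 6],
   [1, 5, 4, 8, 9, 0, 7, 11, 10, 2, 3, 6], [5, 0, 9, 10, 2, 1, 11, 6, 3, 4, 8, 7],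
   [0, 9, 10, 2, 5, 1, 6, 3, 4, 8, 11, 7], [9, 10, 2, 5, 0, 1, 3, 4, 8, 11, 6, 7],
   [10, 2, 5, 0, 9, 1, 4, 8, 11, 6, 3, 7], [2, 5, 0, 9, 10, 1, 8, 11, 6, 3, 4, 7],
   [5, 1, 10, 6, 3, 2, 11, 7, 4, 0, 9, 8], [1, 10, 6, 3, 5, 2, 7, 4, 0, 9, 11, 8],
   [10, 6, 3, 5, 1, 2, 4, 0, 9, 11, 7, 8], [6, 3, 5, 1, 10, 2, 0, 9, 11, 7, 4, 8],
   [3, 5, 1, 10, 6, 2, 9, 11, 7, 4, 0, 8], [4, 5, 2, 6, 7, 3, 10, 11, 8, 0, 1, 9],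
   [5, 2, 6, 7, 4, 3, 11, 8, 0, 1, 10, 9], [2, 6, 7, 4, 5, 3, 8, 0, 1, 10, 11, 9],
   [6, 7, 4, 5, 2, 3, 0, 1, 10, 11, 8, 9], [7, 4, 5, 2, 6, 3, 1, 10, 11, 8, 0, 9],
   [0, 5, 3, 7, 8, 4, 6, 11, 9, 1, 2, 10], [5, 3, 7, 8, 0, 4, 11, 9, 1, 2, 6, 10],
   [3, 7, 8, 0, 5, 4, 9, 1, 2, 6, 11, 10], [7, 8, 0, 5, 3, 4, 1, 2, 6, 11, 9, 10],
   [8, 0, 5, 3, 7, 4, 2, 6, 11, 9, 1, 10], [0, 1, 2, 3, 4, 5, 6, 7, 8, 9, 10, 11],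
   [1, 2, 3, 4, 0, 5, 7, 8, 9, 10, 6, 11], [2, 3, 4, 0, 1, 5, 8, 9, 10, 6, 7, 11],
   [3, 4, 0, 1, 2, 5, 9, 10, 6, 7, 8, 11], [4, 0, 1, 2, 3, 5, 10, 6, 7, 8, 9, 11],
   [2, 10, 11, 7, 3, 6, 8, 4, 5, 1, 9, 0], [10, 11, 7, 3, 2, 6, 4, 5, 1, 9, 8, 0],
   [11, 7, 3, 2, 10, 6, 5, 1, 9, 8, 4, 0], [7, 3, 2, 10, 11, 6, 1, 9, 8, 4, 5, 0],
   [3, 2, 10, 11, 7, 6, 9, 8, 4, 5, 1, 0], [4, 3, 6, 11, 8, 7, 10, 9, 0, 5, 2, 1],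
   [3, 6, 11, 8, 4, 7, 9, 0, 5, 2, 10, 1], [6, 11, 8, 4, 3, 7, 0, 5, 2, 10, 9, 1],
   [11, 8, 4, 3, 6, 7, 5, 2, 10, 9, 0, 1], [8, 4, 3, 6, 11, 7, 2, 10, 9, 0, 5, 1],
   [0, 4, 7, 11, 9, 8, 6, 10, 1, 5, 3, 2], [4, 7, 11, 9, 0, 8, 10, 1, 5, 3, 6, 2],
   [7, 11, 9, 0, 4, 8, 1, 5, 3, 6, 10, 2], [11, 9, 0, 4, 7, 8, 5, 3, 6, 10, 1, 2],
   [9, 0, 4, 7, 11, 8, 3, 6, 10, 1, 5, 2], [0, 8, 11, 10, 1, 9, 6, 2, 5, 4, 7, 3],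
   [8, 11, 10, 1, 0, 9, 2, 5, 4, 7, 6, 3], [11, 10, 1, 0, 8, 9, 5, 4, 7, 6, 2, 3],
   [10, 1, 0, 8, 11, 9, 4, 7, 6, 2, 5, 3], [1, 0, 8, 11, 10, 9, 7, 6, 2, 5, 4, 3],
   [1, 9, 11, 6, 2, 10, 7, 3, 5, 0, 8, 4], [9, 11, 6, 2, 1, 10, 3, 5, 0, 8, 7, 4],
   [11, 6, 2, 1, 9, 10, 5, 0, 8, 7, 3, 4], [6, 2, 1, 9, 11, 10, 0, 8, 7, 3, 5, 4],
   [2, 1, 9, 11, 6, 10, 8, 7, 3, 5, 0, 4], [8, 7, 6, 10, 9, 11, 2, 1, 0, 4, 3, 5],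
   [7, 6, 10, 9, 8, 11, 1, 0, 4, 3, 2, 5], [6, 10, 9, 8, 7, 11, 0, 4, 3, 2, 1, 5],
   [10, 9, 8, 7, 6, 11, 4, 3, 2, 1, 0, 5], [9, 8, 7, 6, 10, 11, 3, 2, 1, 0, 4, 5]]

theorem code_one : code 1 = [0, 1, 2, 3, 4, 5, 6, 7, 8, 9, 10, 11] := by decide +kernel

theorem code_g2 : code g2 = [5, 4, 8, 9, 1, 0, 11, 10, 2, 3, 7, 6] := by decide +kernel

theorem code_g3 : code g3 = [4, 8, 9, 1, 5, 0, 10, 2, 3, 7, 11, 6] := by decide +kernel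

theorem code_evalWord (w : List Bool) : code (evalWord w) = evalWordCode w := by
  induction w with
  | nil => exact code_one
  | cons b w ih => cases b <;> simp [evalWord, evalWordCode, code_mul, ih, code_g2, code_g3]

theorem g2_mem : g2 ∈ icoGroup := Subgroup.subset_closure (by simp)

theorem g3_mem : g3 ∈ icoGroup := Subgroup.subset_closure (by simp)

theorem evalWord_mem (w : List Bool) : evalWord w ∈ icoGroup := by
  induction w with
  | nil => exact one_mem _
  | cons b w ih => cases b <;> simp [evalWord, mul_mem, g2_mem, g3_mem, ih]

/-- The block `[true, false]` spells `g2 * g3`, of order five, which fixes the sixth vertex: twelve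
coset representatives times its five powers. Every listed code therefore comes from a rotation. -/
theorem icoCodes_eq :
    icoCodes = transversalWords.flatMap fun w =>
      (List.range 5).map fun i => evalWordCode (w ++ (List.replicate i [true, false]).flatten) := by
  decide +kernel

/-- Stability under left multiplication by the generators gives the converse: the list is complete.
-/
theorem codeMul_mem_icoCodes : ∀ c ∈ icoCodes,
    codeMul (code g2) c ∈ icoCodes ∧ codeMul (code g3) c ∈ icoCodes := by
  rw [code_g2, code_g3]
  decide +kernel

theorem code_mem_icoCodes {p : Equiv.Perm (Fin 12)} (h : p ∈ icoGroup) : code p ∈ icoCodes := by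
  have h2 : g2⁻¹ = g2 := by decide +kernel
  have h3 : g3⁻¹ = g3 * g3 := by decide +kernel
  refine Subgroup.closure_induction_left (p := fun p _ => code p ∈ icoCodes) ?_ ?_ ?_ h
  · rw [code_one]; decide +kernel
  · rintro x (rfl | rfl) y - hy
    · rw [code_mul]; exact (codeMul_mem_icoCodes _ hy).1
    · rw [code_mul]; exact (codeMul_mem_icoCodes _ hy).2
  · rintro x (rfl | rfl) y - hy
    · rw [h2, code_mul]; exact (codeMul_mem_icoCodes _ hy).1
    · rw [h3, mul_assoc, code_mul, code_mul]
      exact (codeMul_mem_icoCodes _ (codeMul_mem_icoCodes _ hy).2).2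

theorem exists_code_eq {c : List ℕ} (h : c ∈ icoCodes) : ∃ p ∈ icoGroup, code p = c := by
  rw [icoCodes_eq] at h
  simp only [List.mem_flatMap, List.mem_map, ← code_evalWord] at h
  obtain ⟨w, -, i, -, h⟩ := h
  exact ⟨_, evalWord_mem _, h⟩

/-! ### Conjugacy and centralizers in the icosahedral group -/

/-- A five-fold rotation. -/
def g5 : Equiv.Perm (Fin 12) := g2 * g3

theorem code_g5 : code g5 = [1, 2, 3, 4, 0, 5, 7, 8, 9, 10, 6, 11] := by decide +kernel

theorem code_g5_sq : code (g5 * g5) = [2, 3, 4, 0, 1, 5, 8, 9, 10, 6, 7, 11] := by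
  decide +kernel

/-- Rotations of order five form two conjugacy classes, whence both `g5` and its square. Conjugation
is written as `h * x = r * h` to avoid inverses. -/
theorem isConj_check : (icoCodes.all fun x => codeMulEq x x (code 1) (code 1) ||
    icoCodes.any fun h => codeMulEq h x (code g3) h || codeMulEq h x (code g5) h ||
      codeMulEq h x (code (g5 * g5)) h) = true := by
  rw [code_one, code_g3, code_g5, code_g5_sq]
  decide +kernel

theorem exists_conj_of_mul_self_ne_one {x : Equiv.Perm (Fin 12)} (hx : x ∈ icoGroup)
    (hxx : x * x ≠ 1) :
    ∃ h ∈ icoGroup, h * x = g3 * h ∨ h * x = g5 * h ∨ h * x = g5 * g5 * h := by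
  have h := List.all_eq_true.1 isConj_check _ (code_mem_icoCodes hx)
  simp only [Bool.or_eq_true, codeMulEq_iff, List.any_eq_true, mul_one, hxx, false_or] at h
  obtain ⟨c, hc, h⟩ := h
  obtain ⟨k, hk, rfl⟩ := exists_code_eq hc
  simp only [codeMulEq_iff, or_assoc] at h
  exact ⟨k, hk, h⟩

theorem centralizer_check : (icoCodes.all fun a => codeMulEq a (code 1) (code 1) (code 1) ||
    (icoCodes.any fun t => !codeMulEq t a a t && icoCodes.any fun b => codeMulEq t a b t &&
      icoCodes.all fun c => !codeMulEq c a a c || codeMulEq c b b c) &&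
    icoCodes.any fun s => icoCodes.any fun d => codeMulEq s a d s && !codeMulEq a d d a)
      = true := by
  rw [code_one]
  decide +kernel

/-- The centralizer of a non-trivial rotation is a proper subgroup that is normalized by a rotation
outside of it, but it is not normal. -/
theorem exists_normalizing_not_commuting {a : Equiv.Perm (Fin 12)} (ha : a ∈ icoGroup)
    (ha1 : a ≠ 1) :
    (∃ t ∈ icoGroup, t * a ≠ a * t ∧
      ∀ c ∈ icoGroup, c * a = a * c → c * (t * a * t⁻¹) = t * a * t⁻¹ * c) ∧
    ∃ s ∈ icoGroup, a * (s * a * s⁻¹) ≠ s * a * s⁻¹ * a := by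
  have h := List.all_eq_true.1 centralizer_check _ (code_mem_icoCodes ha)
  simp only [Bool.or_eq_true, Bool.and_eq_true, codeMulEq_iff, List.any_eq_true, mul_one, ha1,
    false_or] at h
  obtain ⟨⟨t, ht, h1, b, hb, h2, h3⟩, s, hs, d, hd, h4, h5⟩ := h
  obtain ⟨t, htI, rfl⟩ := exists_code_eq ht
  obtain ⟨b, hbI, rfl⟩ := exists_code_eq hb
  obtain ⟨s, hsI, rfl⟩ := exists_code_eq hs
  obtain ⟨d, hdI, rfl⟩ := exists_code_eq hd
  simp only [Bool.not_eq_true', ← Bool.not_eq_true, codeMulEq_iff] at h1 h2 h4 h5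
  obtain rfl := eq_mul_inv_of_mul_eq h2.symm
  obtain rfl := eq_mul_inv_of_mul_eq h4.symm
  refine ⟨⟨t, htI, h1, fun c hc hca => ?_⟩, s, hsI, h5⟩
  have := List.all_eq_true.1 h3 _ (code_mem_icoCodes hc)
  simpa only [Bool.or_eq_true, Bool.not_eq_true', ← Bool.not_eq_true, codeMulEq_iff, hca,
    not_true, false_or] using this

/-- A maximal subgroup of the icosahedral group is not abelian. -/
theorem exists_not_commute_of_isCoatom {G : Subgroup icoGroup} (hG : IsCoatom G) :
    ∃ a ∈ G, ∃ b ∈ G, a * b ≠ b * a := by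
  by_contra! hcomm
  have key {a : icoGroup} (ha1 : a ≠ 1) (hle : G ≤ Subgroup.centralizer {a}) : False := by
    obtain ⟨⟨t, ht, h1, h2⟩, s, hs, h3⟩ :=
      exists_normalizing_not_commuting a.2 (fun h => ha1 (Subtype.ext h))
    have htc : (⟨t, ht⟩ : icoGroup) ∉ Subgroup.centralizer {a} := fun h =>
      h1 (congrArg Subtype.val (Subgroup.mem_centralizer_singleton_iff.1 h))
    -- By maximality `G` is the whole centralizer of `a`. The normalizer also contains `t`, which
    -- lies outside, so `G` is normal; but an abelian normal subgroup cannot contain both `a` and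
    -- its conjugate by `s`.
    have hGc : Subgroup.centralizer {a} = G := hG.le_iff.1 hle |>.resolve_left fun h =>
      htc (by rw [h]; exact Subgroup.mem_top _)
    have haG : a ∈ G := hGc ▸ Subgroup.mem_centralizer_singleton_iff.2 rfl
    have htn : (⟨t, ht⟩ : icoGroup)⁻¹ ∈ Subgroup.normalizer (G : Set icoGroup) := by
      refine Subgroup.mem_normalizer_fintype fun c hc => ?_
      have hca := congrArg Subtype.val (hcomm c hc a haG)
      have := h2 c c.2 hca
      rw [← hGc]
      refine Subgroup.mem_centralizer_singleton_iff.2 (Subtype.ext ?_)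
      simp only [Subgroup.coe_mul, inv_inv, InvMemClass.coe_inv]
      calc t⁻¹ * c * t * a = t⁻¹ * (c * (t * a * t⁻¹)) * t := by group
        _ = a * (t⁻¹ * c * t) := by rw [this]; group
    have hn : Subgroup.normalizer (G : Set icoGroup) = ⊤ := (hG.le_iff.1
      Subgroup.le_normalizer).resolve_right fun h => htc (by
        rw [hGc, ← h]; exact inv_mem_iff.1 htn)
    have hsa := ((Subgroup.normalizer_eq_top_iff.1 hn).conj_mem a haG ⟨s, hs⟩)
    exact h3 (congrArg Subtype.val (hcomm a haG _ hsa))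
  by_cases h : ∃ a ∈ G, a ≠ 1
  · obtain ⟨a, haG, ha1⟩ := h
    exact key ha1 fun b hb => Subgroup.mem_centralizer_singleton_iff.2 (hcomm b hb a haG)
  · push Not at h
    -- The trivial subgroup lies in every centralizer, so any non-trivial rotation serves.
    refine key (a := ⟨g2, g2_mem⟩) (fun h => ?_) fun b hb => ?_
    · have : g2 ≠ 1 := by decide +kernel
      exact this (congrArg Subtype.val h)
    · rw [h b hb]; exact one_mem _

/-! ### The determinant of a signed permutation -/

/-- The axis through a vertex. -/
def axis (v : Fin 12) : Fin 6 := ⟨v % 6, Nat.mod_lt _ (by norm_num)⟩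

theorem axis_eq_iff (v w : Fin 12) : axis v = axis w ↔ v = w ∨ v = antipode w := by
  revert v w; decide

theorem axis_castAdd (i : Fin 6) : axis (Fin.castAdd 6 i) = i := by
  revert i; decide

theorem axis_apply {p : Equiv.Perm (Fin 12)} (hp : p ∈ signedPerms) (v : Fin 12) :
    axis (p (Fin.castAdd 6 (axis v))) = axis (p v) := by
  have h := (axis_eq_iff _ v).1 (axis_castAdd (axis v))
  rw [axis_eq_iff, ← apply_antipode hp]
  exact h.imp (congrArg p) (congrArg p)

/-- The action of the signed permutations on the six axes. -/
def axisPerm : signedPerms →* Equiv.Perm (Fin 6) :=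
  MonoidHom.toHomPerm
    { toFun := fun p i => axis (p.1 (Fin.castAdd 6 i))
      map_one' := funext axis_castAdd
      map_mul' := fun p q => funext fun i => (axis_apply p.2 (q.1 (Fin.castAdd 6 i))).symm }

/-- The determinant of the signed permutation matrix of a signed permutation `p`: the sign of the
permutation of the twelve vertices is the product of the non-zero entries of the matrix. -/
def signedDet : signedPerms →* ℤˣ :=
  Equiv.Perm.sign.comp signedPerms.subtype * Equiv.Perm.sign.comp axisPerm

/-- The determinant computed from the list of values. -/
def codeDet (l : List ℕ) : ℤˣ :=
  (∏ j : Fin 12, ∏ i ∈ Finset.Iio j, if l.getD i 0 < l.getD j 0 then 1 else -1) *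
    ∏ j : Fin 6, ∏ i ∈ Finset.Iio j, if l.getD i 0 % 6 < l.getD j 0 % 6 then 1 else -1

theorem codeDet_code (p : signedPerms) : codeDet (code p.1) = signedDet p := by
  have h (i : Fin 6) : (code p.1).getD i 0 % 6 = axisPerm p i :=
    congrArg (· % 6) (code_getD p.1 (Fin.castAdd 6 i))
  simp only [signedDet, MonoidHom.mul_apply, MonoidHom.comp_apply,
    Equiv.Perm.sign_eq_prod_prod_Iio, codeDet, code_getD, h, Fin.lt_def, Subgroup.subtype_apply]

/-! ### Signed permutations that intertwine two rotations -/

/-- The list of values of the signed permutation with given values at the first six vertices. -/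
def signedCode (l : List ℕ) : List ℕ := l ++ l.map fun v => (v + 6) % 12

theorem code_eq_signedCode {k : Equiv.Perm (Fin 12)} (hk : k ∈ signedPerms) :
    code k = signedCode (List.ofFn fun i : Fin 6 => (k (Fin.castAdd 6 i) : ℕ)) := by
  have h (i : Fin 6) : ((k (Fin.natAdd 6 i) : Fin 12) : ℕ) = (k (Fin.castAdd 6 i) + 6) % 12 := by
    have h1 : (Fin.natAdd 6 i : Fin 12) = antipode (Fin.castAdd 6 i) := by revert i; decide
    have h2 (v : Fin 12) : ((antipode v : Fin 12) : ℕ) = (v + 6) % 12 := by revert v; decide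
    rw [h1, apply_antipode hk, h2]
  have := List.ofFn_add (m := 6) (n := 6) (f := fun v : Fin (6 + 6) => (k v : ℕ))
  rw [signedCode, List.map_ofFn]
  refine this.trans ?_
  congr 2
  exact funext h

/-- The list of values of the signed permutation that intertwines the three-fold rotation `g3` with
the rotation `r` and has the values `a` and `b` at the first two vertices. -/
def intertwiner3 (r : List ℕ) (a b : ℕ) : List ℕ :=
  let f v := r.getD v 0
  signedCode [a, b, (f b + 6) % 12, f (f b), f a, f (f a)]

/-- The list of values of the signed permutation that intertwines the five-fold rotation `g5` with
the rotation `r` and has the values `a` and `b` at the sixth and the first vertex. -/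
def intertwiner5 (r : List ℕ) (a b : ℕ) : List ℕ :=
  let f v := r.getD v 0
  signedCode [b, f b, f (f b), f (f (f b)), f (f (f (f b))), a]

/-- Whether the list of values `k` belongs to a permutation that intertwines `x` and `r`, has
determinant `1`, does not normalize the icosahedral group, but conjugates into it some rotation
that does not commute with `x`. -/
def badIntertwiner (x r k : List ℕ) : Bool :=
  codeMulEq k x r k && decide k.Nodup && decide (codeDet k = 1) &&
  !((icoCodes.any fun z => codeMulEq k (code g2) z k) &&
    icoCodes.any fun z => codeMulEq k (code g3) z k) &&
  icoCodes.any fun y => !codeMulEq x y y x && icoCodes.any fun z => codeMulEq k y z k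

/-- The exhaustive search behind rigidity. Values `a`, `b` that yield no permutation or no
intertwiner are rejected by the first tests of `badIntertwiner`. -/
theorem badIntertwiner_check : ([code g3, code g5, code (g5 * g5)].all fun r =>
    (List.range 12).all fun a => (List.range 12).all fun b =>
      !badIntertwiner (code g3) r (intertwiner3 r a b) &&
      !badIntertwiner (code g5) r (intertwiner5 r a b)) = true := by
  simp only [badIntertwiner]
  rw [code_g3, code_g5, code_g5_sq, code_g2]
  decide +kernel

/-- The cycles `0 → 4 → 5` and `1 → 8 → 3` of `g3` meet every axis once, and the vertex 8 is
opposite to 2; so the values at 0 and 1 determine `k`. -/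
theorem code_eq_intertwiner3 {k r : Equiv.Perm (Fin 12)} (hk : k ∈ signedPerms)
    (hr : k * g3 = r * k) :
    code k = intertwiner3 (code r) (k 0 : Fin 12) (k 1 : Fin 12) := by
  have h (v : Fin 12) : r (k v) = k (g3 v) :=
    (congrArg (fun q : Equiv.Perm (Fin 12) => q v) hr).symm
  have h2 : ((k 2 : Fin 12) : ℕ) = ((k 8 : Fin 12) + 6) % 12 := by
    have h2 (v : Fin 12) : ((antipode v : Fin 12) : ℕ) = (v + 6) % 12 := by revert v; decide
    have : (2 : Fin 12) = antipode 8 := by decide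
    rw [this, apply_antipode hk, h2]
  have e0 : g3 0 = 4 := by decide
  have e4 : g3 4 = 5 := by decide
  have e1 : g3 1 = 8 := by decide
  have e8 : g3 8 = 3 := by decide
  rw [code_eq_signedCode hk, intertwiner3]
  simp only [code_getD, h, e0, e4, e1, e8, ← h2]
  rfl

/-- The rotation `g5` fixes the vertex 5 and permutes 0, 1, 2, 3, 4 cyclically. -/
theorem code_eq_intertwiner5 {k r : Equiv.Perm (Fin 12)} (hk : k ∈ signedPerms)
    (hr : k * g5 = r * k) :
    code k = intertwiner5 (code r) (k 5 : Fin 12) (k 0 : Fin 12) := by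
  have h (v : Fin 12) : r (k v) = k (g5 v) :=
    (congrArg (fun q : Equiv.Perm (Fin 12) => q v) hr).symm
  have e0 : g5 0 = 1 := by decide
  have e1 : g5 1 = 2 := by decide
  have e2 : g5 2 = 3 := by decide
  have e3 : g5 3 = 4 := by decide
  rw [code_eq_signedCode hk, intertwiner5]
  simp only [code_getD, h, e0, e1, e2, e3]
  rfl

theorem normalizes_of_not_badIntertwiner {k x r y : Equiv.Perm (Fin 12)} (hk : k ∈ signedPerms)
    (hdet : signedDet ⟨k, hk⟩ = 1) (hr : k * x = r * k) (hy : y ∈ icoGroup)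
    (hky : k * y * k⁻¹ ∈ icoGroup) (hxy : x * y ≠ y * x)
    (hbad : badIntertwiner (code x) (code r) (code k) = false) :
    k * g2 * k⁻¹ ∈ icoGroup ∧ k * g3 * k⁻¹ ∈ icoGroup := by
  have key {g : Equiv.Perm (Fin 12)} : (icoCodes.any fun z => codeMulEq (code k) (code g) z (code k))
      = true ↔ k * g * k⁻¹ ∈ icoGroup := by
    rw [List.any_eq_true]
    constructor
    · rintro ⟨z, hz, h⟩
      obtain ⟨z, hzI, rfl⟩ := exists_code_eq hz
      rw [codeMulEq_iff] at h
      rwa [h, mul_inv_cancel_right]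
    · intro h
      exact ⟨_, code_mem_icoCodes h, (codeMulEq_iff _ _ _ _).2 (by group)⟩
  have hnd : (code k).Nodup :=
    List.nodup_ofFn.2 (Fin.val_injective.comp k.injective)
  by_contra hn
  refine Bool.eq_false_iff.1 hbad ?_
  have hd : codeDet (code k) = 1 := (codeDet_code ⟨k, hk⟩).trans hdet
  simp only [badIntertwiner, Bool.and_eq_true, decide_eq_true_eq, codeMulEq_iff]
  refine ⟨⟨⟨⟨hr, hnd⟩, hd⟩, ?_⟩, ?_⟩
  · rwa [Bool.not_eq_true', ← Bool.not_eq_true, Bool.and_eq_true, key, key]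
  · refine List.any_eq_true.2 ⟨_, code_mem_icoCodes hy, ?_⟩
    rw [Bool.and_eq_true, key, Bool.not_eq_true', ← Bool.not_eq_true, codeMulEq_iff]
    exact ⟨hxy, hky⟩

theorem normalizes_of_intertwines {k x r y : Equiv.Perm (Fin 12)} (hk : k ∈ signedPerms)
    (hdet : signedDet ⟨k, hk⟩ = 1) (hx : x = g3 ∨ x = g5) (hr' : r = g3 ∨ r = g5 ∨ r = g5 * g5)
    (hr : k * x = r * k) (hy : y ∈ icoGroup)
    (hky : k * y * k⁻¹ ∈ icoGroup) (hxy : x * y ≠ y * x) :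
    k * g2 * k⁻¹ ∈ icoGroup ∧ k * g3 * k⁻¹ ∈ icoGroup := by
  refine normalizes_of_not_badIntertwiner hk hdet hr hy hky hxy ?_
  have h (a b : Fin 12) := List.all_eq_true.1 (List.all_eq_true.1 (List.all_eq_true.1
    badIntertwiner_check (code r) (by rcases hr' with rfl | rfl | rfl <;> simp))
      a (List.mem_range.2 a.2)) b (List.mem_range.2 b.2)
  simp only [Bool.and_eq_true, Bool.not_eq_true'] at h
  rcases hx with rfl | rfl
  · rw [code_eq_intertwiner3 hk hr]
    exact (h _ _).1
  · rw [code_eq_intertwiner5 hk hr]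
    exact (h _ _).2

/-! ### Rigidity of signed permutations of determinant 1 -/

theorem signedDet_of_mem_icoGroup {p : Equiv.Perm (Fin 12)} (hp : p ∈ icoGroup) :
    signedDet ⟨p, icoGroup_le_signedPerms hp⟩ = 1 := by
  have h : icoCodes.all (fun c => decide (codeDet c = 1)) = true := by decide +kernel
  rw [← codeDet_code]
  exact of_decide_eq_true (List.all_eq_true.1 h _ (code_mem_icoCodes hp))

theorem conj_mem_icoGroup_of_generators {k : Equiv.Perm (Fin 12)}
    (h : k * g2 * k⁻¹ ∈ icoGroup ∧ k * g3 * k⁻¹ ∈ icoGroup) {z : Equiv.Perm (Fin 12)}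
    (hz : z ∈ icoGroup) : k * z * k⁻¹ ∈ icoGroup := by
  have hle : icoGroup ≤ icoGroup.comap (MulAut.conj k).toMonoidHom := by
    refine (Subgroup.closure_le _).2 ?_
    rintro p (rfl | rfl)
    exacts [h.1, h.2]
  exact hle hz

theorem conj_mem_icoGroup_of_conj_generator {k x y h s : Equiv.Perm (Fin 12)} (hk : k ∈ signedPerms)
    (hdet : signedDet ⟨k, hk⟩ = 1) (hs : s = g3 ∨ s = g5) (hh : h ∈ icoGroup) (hx : h * x = s * h)
    (hy : y ∈ icoGroup) (hkx : k * x * k⁻¹ ∈ icoGroup) (hky : k * y * k⁻¹ ∈ icoGroup)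
    (hxy : x * y ≠ y * x) {z : Equiv.Perm (Fin 12)} (hz : z ∈ icoGroup) :
    k * z * k⁻¹ ∈ icoGroup := by
  have hss : s * s ≠ 1 := by rcases hs with rfl | rfl <;> decide +kernel
  obtain rfl : x = h⁻¹ * s * h := by rw [mul_assoc, ← hx, inv_mul_cancel_left]
  obtain ⟨h', hh', hr⟩ := exists_conj_of_mul_self_ne_one hkx fun he => hss (by
    have : s * s = (k * h⁻¹)⁻¹ * (k * (h⁻¹ * s * h) * k⁻¹ * (k * (h⁻¹ * s * h) * k⁻¹)) *
      (k * h⁻¹) := by group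
    rw [this, he]; group)
  obtain ⟨r, hr', hr⟩ : ∃ r, (r = g3 ∨ r = g5 ∨ r = g5 * g5) ∧
      h' * (k * (h⁻¹ * s * h) * k⁻¹) = r * h' := by
    rcases hr with hr | hr | hr
    exacts [⟨_, .inl rfl, hr⟩, ⟨_, .inr (.inl rfl), hr⟩, ⟨_, .inr (.inr rfl), hr⟩]
  have hhW := icoGroup_le_signedPerms hh
  have hhW' := icoGroup_le_signedPerms hh'
  -- Multiplying `k` by rotations on both sides changes neither its determinant nor whether it
  -- normalizes the group, and the product intertwines `s` and `r`.
  have hK : h' * k * h⁻¹ ∈ signedPerms := mul_mem (mul_mem hhW' hk) (inv_mem hhW)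
  have hKdet : signedDet ⟨h' * k * h⁻¹, hK⟩ = 1 := by
    have : (⟨h' * k * h⁻¹, hK⟩ : signedPerms) = ⟨h', hhW'⟩ * ⟨k, hk⟩ * ⟨h, hhW⟩⁻¹ := rfl
    rw [this, map_mul, map_mul, map_inv, hdet, signedDet_of_mem_icoGroup hh,
      signedDet_of_mem_icoGroup hh', mul_one, inv_one, mul_one]
  have hgen := normalizes_of_intertwines (y := h * y * h⁻¹) hK hKdet hs hr' (by
      calc h' * k * h⁻¹ * s = h' * (k * (h⁻¹ * s * h) * k⁻¹) * k * h⁻¹ := by group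
        _ = r * (h' * k * h⁻¹) := by rw [hr]; group)
    (mul_mem (mul_mem hh hy) (inv_mem hh))
    (by
      have : h' * k * h⁻¹ * (h * y * h⁻¹) * (h' * k * h⁻¹)⁻¹ = h' * (k * y * k⁻¹) * h'⁻¹ := by group
      rw [this]
      exact mul_mem (mul_mem hh' hky) (inv_mem hh'))
    (fun he => hxy (by
      calc h⁻¹ * s * h * y = h⁻¹ * (s * (h * y * h⁻¹)) * h := by group
        _ = y * (h⁻¹ * s * h) := by rw [he]; group))
  have hKz := conj_mem_icoGroup_of_generators hgen (mul_mem (mul_mem hh hz) (inv_mem hh))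
  have : k * z * k⁻¹ = h'⁻¹ * (h' * k * h⁻¹ * (h * z * h⁻¹) * (h' * k * h⁻¹)⁻¹) * h' := by group
  rw [this]
  exact mul_mem (mul_mem (inv_mem hh') hKz) hh'

theorem conj_mem_icoGroup_of_mul_self_ne_one {k x y : Equiv.Perm (Fin 12)} (hk : k ∈ signedPerms)
    (hdet : signedDet ⟨k, hk⟩ = 1) (hx : x ∈ icoGroup) (hxx : x * x ≠ 1) (hy : y ∈ icoGroup)
    (hkx : k * x * k⁻¹ ∈ icoGroup) (hky : k * y * k⁻¹ ∈ icoGroup)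
    (hxy : x * y ≠ y * x) {z : Equiv.Perm (Fin 12)} (hz : z ∈ icoGroup) :
    k * z * k⁻¹ ∈ icoGroup := by
  obtain ⟨h, hh, h3 | h5 | h5⟩ := exists_conj_of_mul_self_ne_one hx hxx
  · exact conj_mem_icoGroup_of_conj_generator hk hdet (.inl rfl) hh h3 hy hkx hky hxy hz
  · exact conj_mem_icoGroup_of_conj_generator hk hdet (.inr rfl) hh h5 hy hkx hky hxy hz
  · have h5' : g5 ^ 5 = 1 := by decide +kernel
    obtain rfl : x = h⁻¹ * (g5 * g5) * h := by rw [mul_assoc, ← h5, inv_mul_cancel_left]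
    -- The cube of `x` is conjugate to `g5 ^ 6 = g5`, and its square is `x` again, so `x` and its
    -- cube commute with the same elements.
    have h6 : (h⁻¹ * (g5 * g5) * h) ^ 3 = h⁻¹ * g5 * h := by
      calc (h⁻¹ * (g5 * g5) * h) ^ 3 = h⁻¹ * (g5 ^ 5 * g5) * h := by
            simp [pow_succ, mul_assoc]
        _ = h⁻¹ * g5 * h := by rw [h5', one_mul]
    refine conj_mem_icoGroup_of_conj_generator (x := (h⁻¹ * (g5 * g5) * h) ^ 3) hk hdet (.inr rfl)
      hh (by rw [h6]; group) hy ?_ hky (fun he => hxy ?_) hz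
    · rw [← conj_pow]
      exact pow_mem hkx 3
    · have hc : Commute ((h⁻¹ * (g5 * g5) * h) ^ 3) y := he
      have h7 : ((h⁻¹ * (g5 * g5) * h) ^ 3) ^ 2 = h⁻¹ * (g5 * g5) * h := by
        rw [h6, sq]; group
      have h8 := hc.pow_left 2
      rw [h7] at h8
      exact h8

/-- A signed permutation with determinant `1` that conjugates two rotations that do not commute
into rotations normalizes the icosahedral group. -/
theorem conj_mem_icoGroup {k a b : Equiv.Perm (Fin 12)} (hk : k ∈ signedPerms)
    (hdet : signedDet ⟨k, hk⟩ = 1) (ha : a ∈ icoGroup) (hb : b ∈ icoGroup)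
    (hka : k * a * k⁻¹ ∈ icoGroup) (hkb : k * b * k⁻¹ ∈ icoGroup) (hab : a * b ≠ b * a)
    {z : Equiv.Perm (Fin 12)} (hz : z ∈ icoGroup) : k * z * k⁻¹ ∈ icoGroup := by
  by_cases haa : a * a = 1
  · by_cases hbb : b * b = 1
    -- The product of two non-commuting involutions is not an involution and commutes with neither
    -- of them.
    · refine conj_mem_icoGroup_of_mul_self_ne_one (x := a * b) (y := a) hk hdet (mul_mem ha hb)
        (fun h => hab ?_) ha (by rw [← conj_mul]; exact mul_mem hka hkb) hka
        (fun h => hab ?_) hz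
      · rw [eq_inv_of_mul_eq_one_left h, mul_inv_rev, ← eq_inv_of_mul_eq_one_left haa,
          ← eq_inv_of_mul_eq_one_left hbb]
      · exact (mul_left_cancel ((mul_assoc a b a).symm.trans h)).symm
    · exact conj_mem_icoGroup_of_mul_self_ne_one hk hdet hb hbb ha hkb hka hab.symm hz
  · exact conj_mem_icoGroup_of_mul_self_ne_one hk hdet ha haa hb hka hkb hab hz

/-! ### Orthogonal integral matrices as signed permutations -/

/-- A non-zero integer coordinate already contributes at least 1 to the sum of squares, so all
others vanish. -/
theorem exists_vertexVec_eq {u : Fin 6 → ℤ} (hu : ∑ i, u i * u i = 1) : ∃ v, vertexVec v = u := by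
  obtain ⟨i, hi⟩ : ∃ i, u i ≠ 0 := by
    by_contra! h
    simp [h] at hu
  have hsplit := Finset.add_sum_erase Finset.univ (fun j => u j * u j) (Finset.mem_univ i)
  have hnn : 0 ≤ ∑ j ∈ Finset.univ.erase i, u j * u j :=
    Finset.sum_nonneg fun j _ => mul_self_nonneg _
  have hpos : 0 < u i * u i := mul_self_pos.2 hi
  simp only [hu] at hsplit
  have hz : ∑ j ∈ Finset.univ.erase i, u j * u j = 0 := by omega
  have hi1 : u i * u i = 1 := by omega
  have h0 (j : Fin 6) (hj : j ≠ i) : u j = 0 := mul_self_eq_zero.1 <|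
    (Finset.sum_eq_zero_iff_of_nonneg fun j _ => mul_self_nonneg (u j)).1 hz j
      (Finset.mem_erase.2 ⟨hj, Finset.mem_univ j⟩)
  rcases mul_self_eq_one_iff.1 hi1 with h | h
  · refine ⟨Fin.castAdd 6 i, funext fun j => ?_⟩
    rw [vertexVec_castAdd]
    split_ifs with hj
    exacts [hj ▸ h.symm, (h0 j hj).symm]
  · refine ⟨antipode (Fin.castAdd 6 i), funext fun j => ?_⟩
    rw [vertexVec_antipode, vertexVec_castAdd]
    split_ifs with hj
    exacts [hj ▸ h.symm, by rw [h0 j hj, neg_zero]]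

theorem vertexVec_injective : Function.Injective vertexVec := by
  have h : ∀ v w, (∀ i, vertexVec v i = vertexVec w i) → v = w := by decide +kernel
  exact fun v w hvw => h v w (congrFun hvw)

theorem exists_vertexVec_mulVec (A : B6) (v : Fin 12) :
    ∃ w, vertexVec w = A.1.mulVec (vertexVec v) := by
  refine exists_vertexVec_eq ?_
  have h1 : ∑ i, vertexVec v i * vertexVec v i = 1 := by revert v; decide +kernel
  have hA : A.1.transpose * A.1 = 1 := (Matrix.mem_orthogonalGroup_iff' (Fin 6) ℤ).1 A.2
  change A.1.mulVec (vertexVec v) ⬝ᵥ A.1.mulVec (vertexVec v) = 1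
  rw [Matrix.dotProduct_mulVec, Matrix.vecMul_mulVec, ← Matrix.mulVec_transpose,
    Matrix.transpose_mul, Matrix.transpose_transpose, hA, Matrix.one_mulVec]
  exact h1

/-- The action of `B₆` on the twelve vectors `±e₁, …, ±e₆`. -/
noncomputable def vertexPerm : B6 →* Equiv.Perm (Fin 12) :=
  MonoidHom.toHomPerm
    { toFun := fun A v => (exists_vertexVec_mulVec A v).choose
      map_one' := funext fun v => vertexVec_injective <| by
        rw [(exists_vertexVec_mulVec 1 v).choose_spec]
        exact Matrix.one_mulVec _
      map_mul' := fun A B => funext fun v => vertexVec_injective <| by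
        change _ = vertexVec (exists_vertexVec_mulVec A _).choose
        rw [(exists_vertexVec_mulVec (A * B) v).choose_spec,
          (exists_vertexVec_mulVec A _).choose_spec, (exists_vertexVec_mulVec B v).choose_spec,
          Matrix.mulVec_mulVec]
        rfl }

theorem vertexVec_vertexPerm (A : B6) (v : Fin 12) :
    vertexVec (vertexPerm A v) = A.1.mulVec (vertexVec v) :=
  (exists_vertexVec_mulVec A v).choose_spec

theorem vertexPerm_mem (A : B6) : vertexPerm A ∈ signedPerms := by
  refine Subgroup.mem_centralizer_singleton_iff.2 (Equiv.ext fun v => vertexVec_injective ?_)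
  have h (w : Fin 12) : vertexVec (antipode w) = -vertexVec w := funext (vertexVec_antipode w)
  simp only [Equiv.Perm.mul_apply]
  rw [h, vertexVec_vertexPerm, vertexVec_vertexPerm, h, Matrix.mulVec_neg]

theorem vertexPerm_injective : Function.Injective vertexPerm := by
  intro A B h
  refine Subtype.ext (Matrix.ext_of_mulVec_single fun j => ?_)
  have hj : (Pi.single j 1 : Fin 6 → ℤ) = vertexVec (Fin.castAdd 6 j) := by
    ext i
    rw [vertexVec_castAdd, Pi.single_apply]
  rw [hj, ← vertexVec_vertexPerm, ← vertexVec_vertexPerm, h]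

theorem vertexPerm_icoRep (p : icoGroup) : vertexPerm (icoRep p) = p := by
  refine Equiv.ext fun v => vertexVec_injective ?_
  rw [vertexVec_vertexPerm]
  exact funext fun i => sum_signedMatrix_mul (icoGroup_le_signedPerms p.2) v i

theorem mem_range_icoRep {A : B6} : A ∈ icoRep.range ↔ vertexPerm A ∈ icoGroup := by
  constructor
  · rintro ⟨p, rfl⟩
    rw [vertexPerm_icoRep]
    exact p.2
  · intro h
    exact ⟨⟨_, h⟩, vertexPerm_injective (vertexPerm_icoRep _)⟩

/-! ### The colouring of the crystallographic representations -/

/-- The determinant of an element of `B₆`, through its action on the vertices. -/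
noncomputable def orthogonalDet : B6 →* ℤˣ :=
  signedDet.comp (vertexPerm.codRestrict signedPerms vertexPerm_mem)

theorem mem_map_conj_iff {G : Type*} [Group G] {H : Subgroup G} {g x : G} :
    x ∈ H.map (MulAut.conj g).toMonoidHom ↔ g⁻¹ * x * g ∈ H := by
  constructor
  · rintro ⟨y, hy, rfl⟩
    simpa [mul_assoc] using hy
  · intro h
    exact ⟨_, h, by simp [mul_assoc]⟩

theorem map_conj_range_icoRep_le {g₁ g₂ A B : B6} (hdet : orthogonalDet g₁ = orthogonalDet g₂)
    (hA : A ∈ icoRep.range.map (MulAut.conj g₁).toMonoidHom ⊓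
      icoRep.range.map (MulAut.conj g₂).toMonoidHom)
    (hB : B ∈ icoRep.range.map (MulAut.conj g₁).toMonoidHom ⊓
      icoRep.range.map (MulAut.conj g₂).toMonoidHom) (hAB : A * B ≠ B * A) :
    icoRep.range.map (MulAut.conj g₁).toMonoidHom ≤
      icoRep.range.map (MulAut.conj g₂).toMonoidHom := by
  intro Z hZ
  simp only [Subgroup.mem_inf, mem_map_conj_iff, mem_range_icoRep] at hA hB hZ ⊢
  have key (X : B6) : vertexPerm (g₂⁻¹ * g₁) * vertexPerm (g₁⁻¹ * X * g₁) *
      (vertexPerm (g₂⁻¹ * g₁))⁻¹ = vertexPerm (g₂⁻¹ * X * g₂) := by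
    rw [← map_mul, ← map_inv, ← map_mul]
    congr 1
    group
  rw [← key]
  refine conj_mem_icoGroup (vertexPerm_mem _) ?_ hA.1 hB.1 (by rw [key]; exact hA.2)
    (by rw [key]; exact hB.2) (fun h => hAB ?_) hZ
  · change orthogonalDet (g₂⁻¹ * g₁) = 1
    rw [map_mul, map_inv, hdet, inv_mul_cancel]
  · rw [← map_mul, ← map_mul] at h
    have h' := vertexPerm_injective h
    calc A * B = g₁ * (g₁⁻¹ * A * g₁ * (g₁⁻¹ * B * g₁)) * g₁⁻¹ := by group
      _ = B * A := by rw [h']; group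

/-- The determinant of a matrix that conjugates the standard representation into a given one. -/
noncomputable def repDet (H : CrystRep) : ℤˣ := orthogonalDet H.2.choose

/-- The argument works for any choice of conjugating matrices, so `repDet` need not be shown
independent of the choice. -/
theorem repDet_ne_of_adj {G : Subgroup icoGroup} (hG : IsCoatom G) {H₁ H₂ : CrystRep}
    (h : (subgroupGraph G).Adj H₁ H₂) :
    repDet H₁ ≠ repDet H₂ := by
  obtain ⟨hne, P, ⟨c, rfl⟩, hP⟩ := h
  obtain ⟨a, ha, b, hb, hab⟩ := exists_not_commute_of_isCoatom hG
  have hmem {x : icoGroup} (hx : x ∈ G) : MulAut.conj c (icoRep x) ∈ H₁.1 ⊓ H₂.1 := by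
    rw [← hP]
    exact Subgroup.mem_map_of_mem _ (Subgroup.mem_map_of_mem _ hx)
  have hcomm : MulAut.conj c (icoRep a) * MulAut.conj c (icoRep b) ≠
      MulAut.conj c (icoRep b) * MulAut.conj c (icoRep a) := by
    intro h
    rw [← map_mul (MulAut.conj c), ← map_mul (MulAut.conj c)] at h
    replace h := (MulAut.conj c).injective h
    rw [← map_mul, ← map_mul] at h
    have h' := congrArg vertexPerm h
    rw [vertexPerm_icoRep, vertexPerm_icoRep] at h'
    exact hab (Subtype.ext h')
  intro hdet
  have hA := hmem ha
  have hB := hmem hb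
  have h1 := H₁.2.choose_spec
  have h2 := H₂.2.choose_spec
  refine hne (Subtype.ext ?_)
  rw [h1, h2] at hA hB ⊢
  exact le_antisymm (map_conj_range_icoRep_le hdet hA hB hcomm)
    (map_conj_range_icoRep_le hdet.symm ⟨hA.2, hA.1⟩ ⟨hB.2, hB.1⟩ hcomm)

/-- The colouring of the `G`-graph of a maximal subgroup `G` by determinants. -/
noncomputable def detColoring {G : Subgroup icoGroup} (hG : IsCoatom G) :
    (subgroupGraph G).Coloring Bool :=
  SimpleGraph.Coloring.mk (fun H => decide (repDet H = 1)) fun {H₁ H₂} h he => by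
    have hne := repDet_ne_of_adj hG h
    have hiff := decide_eq_decide.1 he
    rcases Int.units_eq_one_or (repDet H₁) with h1 | h1
    · exact hne (h1.trans (hiff.1 h1).symm)
    · rcases Int.units_eq_one_or (repDet H₂) with h2 | h2
      · exact hne ((hiff.2 h2).trans h2.symm)
      · exact hne (h1.trans h2.symm)

end IcosahedralGraph

open IcosahedralGraph in
open scoped Classical in
theorem mainTheorem5 (G : Subgroup icoGroup) (hG : IsCoatom G) :
    (subgroupGraph G).CliqueFree 3 ∧
    (∀ (H : CrystRep) (c : (subgroupGraph G).Walk H H), c.IsCircuit → c.length ≠ 3) ∧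
    (∀ H : CrystRep, ((subgroupGraph G).adjMatrix ℤ ^ 3) H H = 0) := by
  have hlen (H : CrystRep) (c : (subgroupGraph G).Walk H H) : c.length ≠ 3 := by
    intro h3
    -- A closed walk ends at the colour where it began, so its length is even.
    have h := ((detColoring hG).even_length_iff_congr c).2 Iff.rfl
    rw [h3] at h
    exact absurd h (by decide)
  refine ⟨(detColoring hG).colorable.cliqueFree (by decide), fun H c _ => hlen H c, fun H => ?_⟩
  rw [SimpleGraph.adjMatrix_pow_apply_eq_card_walk, Nat.cast_eq_zero, Fintype.card_eq_zero_iff]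
  exact ⟨fun c => hlen H c.1 c.2⟩
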